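/- Let $\mathrm{Circ}=(\mathbb R^2\setminus\{0\})/\mathbb R_{>0}$ be the circle of rays leaving the origin, with the quotient topology, on which $GL(2,\mathbb R)$ acts. Let $$\mathbf G^\pm=(\mathbb Z_2*\mathbb Z_2*\mathbb Z_2)\oplus\mathbb Z_2,$$ where the three free factors are generated by $A$, $B$, $C$ and the last, central, factor by $-I$. For $c\ge 1$ let $G\mapsto G_c$ be the homomorphism $\mathbf G^\pm\to GL(2,\mathbb R)$ with $(-I)_c=-I$ and $$A_c=\begin{pmatrix}-1&0\\0&1\end{pmatrix},\qquad B_c=\begin{pmatrix}-1&2\\0&1\end{pmatrix},\qquad C_c=\begin{pmatrix}-c&c-1\\-c-1&c\end{pmatrix}.$$ Then for every $c>1$ there is a continuous, (non-strictly) monotonic map $\varphi_c:\mathrm{Circ}\to\mathrm{Circ}$ of degree one (that is, $\varphi_c$ lifts through $t\mapsto\mathbb R_{>0}(\cos t,\sin t)$ to a continuous non-decreasing map $F:\mathbb R\to\mathbb R$ with $F(t+2\pi)=F(t)+2\pi$) such that $$\varphi_c\circ G_c=G_1\circ\varphi_c\qquad\text{on }\mathrm{Circ},\text{ for all }G\in\mathbf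 G^\pm .$$ Moreover $\varphi_c$ can be chosen so that it also fixes the horizontal ray $\{(x,0):x>0\}$ and the slope-one ray $\{(x,x):x>0\}$, and commutes with the rotation of the plane by $\pi$. -/

import Mathlib

namespace VeechRays

open Matrix

/-- The circle of rays leaving the origin of the plane, `(ℝ² ∖ {0}) / ℝ_{>0}`. -/
abbrev Circ : Type := Module.Ray ℝ (Fin 2 → ℝ)

/-- The quotient topology on the circle of rays, inherited from `ℝ² ∖ {0}`. -/
instance Circ.topologicalSpace : TopologicalSpace Circ :=
  TopologicalSpace.coinduced
    (fun v : {v : Fin 2 → ℝ // v ≠ 0} => rayOfNeZero ℝ v.1 v.2) inferInstance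

theorem dir_ne_zero (t : ℝ) : (![Real.cos t, Real.sin t] : Fin 2 → ℝ) ≠ 0 := by
  intro h
  have h0 : Real.cos t = 0 := congrFun h 0
  have h1 : Real.sin t = 0 := congrFun h 1
  simpa [h0, h1] using Real.sin_sq_add_cos_sq t

/-- The ray at angle `t`; this is the universal covering `ℝ → Circ`. -/
noncomputable def rayAt (t : ℝ) : Circ :=
  rayOfNeZero ℝ ![Real.cos t, Real.sin t] (dir_ne_zero t)

/-- The horizontal ray `{(x, 0) : x > 0}`. -/
noncomputable def horizontalRay : Circ :=
  rayOfNeZero ℝ ![1, 0] (fun h => one_ne_zero (congrFun h 0))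

/-- The slope one ray `{(x, x) : x > 0}`. -/
noncomputable def slopeOneRay : Circ :=
  rayOfNeZero ℝ ![1, 1] (fun h => one_ne_zero (congrFun h 0))

/-- A self-map of the circle of rays is (non-strictly) monotonic of degree one if it lifts to a
continuous non-decreasing map of the universal cover `ℝ` that commutes with the deck
transformation `t ↦ t + 2π`. (Continuity of the lift is essential: a constant map of the circle
has discontinuous non-decreasing lifts which commute with `t ↦ t + 2π`.) -/
def IsMonotoneDegreeOne (φ : Circ → Circ) : Prop :=
  ∃ F : ℝ → ℝ, Continuous F ∧ Monotone F ∧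
    (∀ t, F (t + 2 * Real.pi) = F t + 2 * Real.pi) ∧ ∀ t, φ (rayAt t) = rayAt (F t)

/-- The action of an invertible matrix on rays, `ℝ_{>0} v ↦ ℝ_{>0} (M v)`. -/
noncomputable def rayAct (M : GL (Fin 2) ℝ) : Circ → Circ :=
  Module.Ray.map (LinearMap.GeneralLinearGroup.generalLinearEquiv ℝ (Fin 2 → ℝ)
    (Matrix.GeneralLinearGroup.toLin M))

/-- Names of the generators of `𝐆^±`; `negI` stands for `-I`. -/
inductive Gen
  | A
  | B
  | C
  | negI

open FreeGroup commutatorElement in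
/-- The defining relations: the four generators are involutions, and `-I` is central. -/
def rels : Set (FreeGroup Gen) :=
  {of Gen.A * of Gen.A, of Gen.B * of Gen.B, of Gen.C * of Gen.C, of Gen.negI * of Gen.negI,
    ⁅of Gen.negI, of Gen.A⁆, ⁅of Gen.negI, of Gen.B⁆, ⁅of Gen.negI, of Gen.C⁆}

/-- The abstract group `𝐆^± = (ℤ₂ ∗ ℤ₂ ∗ ℤ₂) ⊕ ℤ₂`, the free factors being generated by `A`, `B`
and `C` and the central factor by `-I`. -/
abbrev GPM : Type := PresentedGroup rels

/-- `A_c` (it does not depend on `c`). -/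
def matA : Matrix (Fin 2) (Fin 2) ℝ := !![-1, 0; 0, 1]

/-- `B_c` (it does not depend on `c`). -/
def matB : Matrix (Fin 2) (Fin 2) ℝ := !![-1, 2; 0, 1]

/-- `C_c`. -/
def matC (c : ℝ) : Matrix (Fin 2) (Fin 2) ℝ := !![-c, c - 1; -c - 1, c]

theorem matA_sq : matA * matA = 1 := by
  ext i j
  fin_cases i <;> fin_cases j <;> simp [matA]

theorem matB_sq : matB * matB = 1 := by
  ext i j
  fin_cases i <;> fin_cases j <;> simp [matB]

theorem matC_sq (c : ℝ) : matC c * matC c = 1 := by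
  ext i j
  fin_cases i <;> fin_cases j <;> simp [matC] <;> ring

/-- The matrices `A_c`, `B_c`, `C_c`, `-I` in `GL(2, ℝ)`; each is its own inverse. -/
def genMat (c : ℝ) : Gen → GL (Fin 2) ℝ
  | Gen.A => ⟨matA, matA, matA_sq, matA_sq⟩
  | Gen.B => ⟨matB, matB, matB_sq, matB_sq⟩
  | Gen.C => ⟨matC c, matC c, matC_sq c, matC_sq c⟩
  | Gen.negI => -1

open commutatorElement in
theorem genMat_rels (c : ℝ) : ∀ r ∈ rels, FreeGroup.lift (genMat c) r = 1 := by
  have hA : genMat c Gen.A * genMat c Gen.A = 1 := Units.ext matA_sq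
  have hB : genMat c Gen.B * genMat c Gen.B = 1 := Units.ext matB_sq
  have hC : genMat c Gen.C * genMat c Gen.C = 1 := Units.ext (matC_sq c)
  have hJ : genMat c Gen.negI * genMat c Gen.negI = 1 := by simp [genMat]
  have hcomm : ∀ M : GL (Fin 2) ℝ, ⁅genMat c Gen.negI, M⁆ = 1 := by
    intro M
    rw [commutatorElement_eq_one_iff_mul_comm]
    simp [genMat]
  intro r hr
  simp only [rels, Set.mem_insert_iff, Set.mem_singleton_iff] at hr
  rcases hr with rfl | rfl | rfl | rfl | rfl | rfl | rfl <;>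
    simp [map_commutatorElement, hA, hB, hC, hJ, hcomm]

/-- The representation `G ↦ G_c` of `𝐆^±` in `GL(2, ℝ)`, sending the generators `A`, `B`, `C`, `-I`
to `A_c`, `B_c`, `C_c`, `-I`. Its image is the group `𝐆_c^±`. -/
def rep (c : ℝ) : GPM →* GL (Fin 2) ℝ :=
  PresentedGroup.toGroup (genMat_rels c)

end VeechRays

/-!
The group is generated by reflections, so a map of the circle of rays is equivariant as soon as it
commutes with `A`, `B`, `C` and `-I`. On the inverse slopes `u = x / y` these act by
`u ↦ -u`, `u ↦ 2 - u` and a Möbius involution depending on `c`. In the coordinate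
`w = (c + 1) u - c` they become
`A : w ↦ -2 c - w`, `B : w ↦ 2 - w`, `C : w ↦ w⁻¹`,
so that `c` only enters through `A`; the target is the case `c = 1`. Thus what is needed is a continuous non-decreasing `f : ℝ → ℝ`
with `f (2 - w) = 2 - f w`, `f (-2 c - w) = -2 - f w` and `f w⁻¹ = (f w)⁻¹`, which is constant on
the gap `[-c, -1]` between the fixed points of `A` and `C` (`exists_isProfile_inv`).

The first two equations extend any function on `[-c, 1]` to the line (`dihedralExt`). The third
one makes `f` a fixed point of the operator `inversionStep`, which replaces `f` on `[-1, 1]` by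
`w ↦ (f w⁻¹)⁻¹`. The point `1` is fixed by the parabolic element `B C_1`, so this is not a uniform
contraction. But `|f w⁻¹| ≥ 1` for `|w| ≤ 1`, and inversion away from the unit interval decreases a
distance `δ` to at most `δ / (1 + δ)` (`abs_inv_sub_inv_le`). Hence the `n`-th iterates of any two
profiles are at distance at most `2 / (1 + 2 n)`, and the iteration converges uniformly.

A profile differs from a linear function by a bounded amount. With `g` the profile in the coordinate
`u`, the homogeneous map `(x, y) ↦ (y g (x / y), y)` therefore extends continuously by the identity
to the horizontal axis (`planeMap`), and the map it induces on rays is `φ`. A vector and its image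
form an acute angle, since `g` preserves signs; adding this oriented angle to `t` gives the lift
(`angleMap`), whose monotonicity is that of `g`.
-/

namespace VeechRays

open Filter Topology

/-! ### Functions commuting with two reflections of the line -/

/-- A monotone continuous function intertwining the reflections of the line in `1` and `-c` with
those in `1` and `-1`. In the coordinate on slopes used below these are the actions of `B` and `A`;
the condition at `-1` says that the gap `[-c, -1]` is collapsed. The condition at `0` lets `0⁻¹ = 0`
stand for the point at infinity. -/
structure IsProfile (c : ℝ) (f : ℝ → ℝ) : Prop where
  mono : Monotone f
  cont : Continuous f
  refl_one : ∀ w, f (2 - w) = 2 - f w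
  refl_neg : ∀ w, f (-2 * c - w) = -2 - f w
  neg_one : f (-1) = -1
  zero : f 0 = 0

namespace IsProfile

variable {c : ℝ} {f : ℝ → ℝ}

theorem one (hf : IsProfile c f) : f 1 = 1 := by
  have h := hf.refl_one 1
  norm_num at h
  linarith

theorem neg_left (hf : IsProfile c f) : f (-c) = -1 := by
  have h := hf.refl_neg (-c)
  rw [show -2 * c - -c = -c by ring] at h
  linarith

end IsProfile

/-- `[-c, 1]` is a fundamental domain for the group generated by the reflections in its ends. -/
theorem forall_of_reflections {c : ℝ} (hc : -1 < c) {p : ℝ → Prop}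
    (h : ∀ w ∈ Set.Icc (-c) 1, p w) (h₁ : ∀ w, p w → p (2 - w))
    (h₂ : ∀ w, p w → p (-2 * c - w)) (w : ℝ) : p w := by
  have up : ∀ w, p w → p (w + 2 * (1 + c)) := fun w hw => by
    have := h₁ _ (h₂ w hw)
    rwa [show 2 - (-2 * c - w) = w + 2 * (1 + c) by ring] at this
  have down : ∀ w, p w → p (w - 2 * (1 + c)) := fun w hw => by
    have := h₂ _ (h₁ w hw)
    rwa [show -2 * c - (2 - w) = w - 2 * (1 + c) by ring] at this
  have trans : ∀ (n : ℤ) (w : ℝ), p w → p (w + n * (2 * (1 + c))) := fun n => by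
    induction n using Int.induction_on with
    | zero => intro w hw; simpa using hw
    | succ n ih =>
      intro w hw
      have := up _ (ih w hw)
      push_cast at this ⊢
      rwa [show w + (n + 1) * (2 * (1 + c)) = w + n * (2 * (1 + c)) + 2 * (1 + c) by ring]
    | pred n ih =>
      intro w hw
      have := down _ (ih w hw)
      push_cast at this ⊢
      rwa [show w + (-n - 1) * (2 * (1 + c)) = w + -n * (2 * (1 + c)) - 2 * (1 + c) by ring]
  have hp : 0 < 2 * (1 + c) := by linarith
  have e : w = 2 * (1 + c) * Int.fract ((w + c) / (2 * (1 + c))) - c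
      + ⌊(w + c) / (2 * (1 + c))⌋ * (2 * (1 + c)) := by
    have h3 := Int.fract_add_floor ((w + c) / (2 * (1 + c)))
    have h4 : (w + c) / (2 * (1 + c)) * (2 * (1 + c)) = w + c := div_mul_cancel₀ _ hp.ne'
    rw [← h3] at h4
    linarith
  rw [e]
  apply trans
  have h5 := Int.fract_nonneg ((w + c) / (2 * (1 + c)))
  have h6 := (Int.fract_lt_one ((w + c) / (2 * (1 + c)))).le
  generalize Int.fract ((w + c) / (2 * (1 + c))) = θ at h5 h6
  rcases le_total (2 * (1 + c) * θ - c) 1 with h7 | h7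
  · exact h _ ⟨by nlinarith, h7⟩
  · have h8 := h₁ _ (h (2 - (2 * (1 + c) * θ - c)) ⟨by nlinarith, by linarith⟩)
    rwa [sub_sub_cancel] at h8

/-- The extension by the reflections in `1` and `-c` of the restriction of `h` to `[-c, 1]`, for
`h` with constant value `-1` to the left and `1` to the right of this interval. The bracket
`h w + 1 - h (2 - w)` is the extension to the period `[-c, c + 2]`. -/
noncomputable def dihedralExt (c : ℝ) (h : ℝ → ℝ) (w : ℝ) : ℝ :=
  4 * ⌊(w + c) / (2 * (1 + c))⌋ +
    (h (2 * (1 + c) * Int.fract ((w + c) / (2 * (1 + c))) - c) + 1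
      - h (2 - (2 * (1 + c) * Int.fract ((w + c) / (2 * (1 + c))) - c)))

section dihedralExt

variable {c : ℝ} {h : ℝ → ℝ}

theorem dihedralExt_apply (hc : -1 < c) (hr : ∀ w, 1 ≤ w → h w = 1) {w : ℝ}
    (hw : w ∈ Set.Icc (-c) 1) : dihedralExt c h w = h w := by
  have hp : 0 < 2 * (1 + c) := by linarith
  have h0 : 0 ≤ (w + c) / (2 * (1 + c)) := div_nonneg (by linarith [hw.1]) hp.le
  have h1 : (w + c) / (2 * (1 + c)) < 1 := by rw [div_lt_one hp]; linarith [hw.2]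
  have e : 2 * (1 + c) * ((w + c) / (2 * (1 + c))) - c = w := by
    rw [mul_div_cancel₀ _ hp.ne']; ring
  rw [dihedralExt, Int.fract_eq_self.2 ⟨h0, h1⟩, Int.floor_eq_zero_iff.2 ⟨h0, h1⟩, e,
    hr (2 - w) (by linarith [hw.2])]
  simp

theorem continuous_dihedralExt (hc : 1 < c) (hh : Continuous h) (hl : ∀ w, w ≤ -1 → h w = -1)
    (hr : ∀ w, 1 ≤ w → h w = 1) : Continuous (dihedralExt c h) := by
  -- `dihedralExt c h` minus the linear function of the same growth is periodic
  let κ : ℝ → ℝ := fun x =>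
    h (2 * (1 + c) * x - c) + 1 - h (2 - (2 * (1 + c) * x - c)) - 4 * x
  have hκ : Continuous κ := by fun_prop
  have hκ01 : κ 0 = κ 1 := by
    simp only [κ]
    rw [hl _ (by linarith), hr _ (by linarith), hr (2 * (1 + c) * 1 - c) (by linarith),
      hl _ (by linarith)]
    norm_num
  have e : dihedralExt c h =
      fun w => (κ ∘ Int.fract) ((w + c) / (2 * (1 + c))) + 4 * ((w + c) / (2 * (1 + c))) := by
    funext w
    have := Int.fract_add_floor ((w + c) / (2 * (1 + c)))
    simp only [dihedralExt, κ, Function.comp]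
    linarith
  rw [e]
  exact ((ContinuousOn.comp_fract'' hκ.continuousOn hκ01).comp (by fun_prop)).add (by fun_prop)

theorem monotone_dihedralExt (hc : 1 < c) (hh : Monotone h) (hl : ∀ w, w ≤ -1 → h w = -1)
    (hr : ∀ w, 1 ≤ w → h w = 1) : Monotone (dihedralExt c h) := by
  have hp : 0 < 2 * (1 + c) := by linarith
  have lb : ∀ w, -1 ≤ h w := fun w => by
    rw [← hl (min w (-1)) (min_le_right _ _)]; exact hh (min_le_left _ _)
  have ub : ∀ w, h w ≤ 1 := fun w => by
    rw [← hr (max w 1) (le_max_right _ _)]; exact hh (le_max_left _ _)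
  intro v w hvw
  have hx : (v + c) / (2 * (1 + c)) ≤ (w + c) / (2 * (1 + c)) := by gcongr
  simp only [dihedralExt]
  generalize (v + c) / (2 * (1 + c)) = x at hx
  generalize (w + c) / (2 * (1 + c)) = y at hx
  rcases (Int.floor_mono hx).eq_or_lt with hn | hn
  · have hθ : Int.fract x ≤ Int.fract y := by
      rw [Int.fract, Int.fract, hn]; linarith
    have h1 : 2 * (1 + c) * Int.fract x - c ≤ 2 * (1 + c) * Int.fract y - c := by gcongr
    have h2 := hh h1
    have h3 := hh (sub_le_sub_left h1 2)
    rw [hn]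
    linarith
  · have hn' : (⌊x⌋ : ℝ) + 1 ≤ ⌊y⌋ := by exact_mod_cast hn
    linarith [ub (2 * (1 + c) * Int.fract x - c), lb (2 - (2 * (1 + c) * Int.fract x - c)),
      lb (2 * (1 + c) * Int.fract y - c), ub (2 - (2 * (1 + c) * Int.fract y - c))]

theorem dihedralExt_refl_one (hc : 1 < c) (hl : ∀ w, w ≤ -1 → h w = -1)
    (hr : ∀ w, 1 ≤ w → h w = 1) (w : ℝ) :
    dihedralExt c h (2 - w) = 2 - dihedralExt c h w := by
  have hp : 0 < 2 * (1 + c) := by linarith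
  have e : (2 - w + c) / (2 * (1 + c)) = 1 - (w + c) / (2 * (1 + c)) := by
    field_simp; ring
  simp only [dihedralExt, e]
  generalize (w + c) / (2 * (1 + c)) = x
  by_cases hx : Int.fract x = 0
  · have hx' : x = ⌊x⌋ := by linarith [Int.fract_add_floor x]
    have e1 : (1 : ℝ) - x = ((1 - ⌊x⌋ : ℤ) : ℝ) := by push_cast; rw [← hx']
    rw [e1, Int.fract_intCast, Int.floor_intCast, hx, hl _ (by linarith), hr _ (by linarith)]
    push_cast
    ring
  · have h0 : 0 < Int.fract x := lt_of_le_of_ne (Int.fract_nonneg x) (Ne.symm hx)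
    have h1 := Int.fract_lt_one x
    have e2 : (1 : ℝ) - x = (1 - Int.fract x) + ((-⌊x⌋ : ℤ) : ℝ) := by
      push_cast; linarith [Int.fract_add_floor x]
    have e3 : Int.fract (1 - x) = 1 - Int.fract x := by
      rw [e2, Int.fract_add_intCast, Int.fract_eq_self.2 ⟨by linarith, by linarith⟩]
    have e4 : ⌊1 - x⌋ = -⌊x⌋ := by
      rw [e2, Int.floor_add_intCast, Int.floor_eq_zero_iff.2 ⟨by linarith, by linarith⟩, zero_add]
    rw [e3, e4, show 2 * (1 + c) * (1 - Int.fract x) - c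
      = 2 - (2 * (1 + c) * Int.fract x - c) by ring, sub_sub_cancel]
    push_cast
    ring

theorem dihedralExt_refl_neg (hc : 1 < c) (hl : ∀ w, w ≤ -1 → h w = -1)
    (hr : ∀ w, 1 ≤ w → h w = 1) (w : ℝ) :
    dihedralExt c h (-2 * c - w) = -2 - dihedralExt c h w := by
  have e : (w + 2 * (1 + c) + c) / (2 * (1 + c)) = (w + c) / (2 * (1 + c)) + 1 := by
    have : 0 < 1 + c := by linarith
    field_simp; ring
  have e' : dihedralExt c h (w + 2 * (1 + c)) = dihedralExt c h w + 4 := by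
    simp only [dihedralExt, e, Int.fract_add_one, Int.floor_add_one]
    push_cast
    ring
  rw [show -2 * c - w = 2 - (w + 2 * (1 + c)) by ring, dihedralExt_refl_one hc hl hr, e']
  ring

theorem isProfile_dihedralExt (hc : 1 < c) (hcont : Continuous h) (hh : Monotone h)
    (hl : ∀ w, w ≤ -1 → h w = -1) (hr : ∀ w, 1 ≤ w → h w = 1) (hz : h 0 = 0) :
    IsProfile c (dihedralExt c h) where
  mono := monotone_dihedralExt hc hh hl hr
  cont := continuous_dihedralExt hc hcont hl hr
  refl_one := dihedralExt_refl_one hc hl hr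
  refl_neg := dihedralExt_refl_neg hc hl hr
  neg_one := by
    rw [dihedralExt_apply (by linarith) hr ⟨by linarith, by norm_num⟩, hl _ le_rfl]
  zero := by rw [dihedralExt_apply (by linarith) hr ⟨by linarith, by norm_num⟩, hz]

end dihedralExt

namespace IsProfile

variable {c : ℝ} {f g : ℝ → ℝ}

theorem mem_Icc (hf : IsProfile c f) {w : ℝ} (hw : w ∈ Set.Icc (-c) 1) :
    f w ∈ Set.Icc (-1) 1 :=
  ⟨hf.neg_left ▸ hf.mono hw.1, hf.one ▸ hf.mono hw.2⟩

/-- A profile stays at bounded distance from the linear function of the same growth. -/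
theorem abs_sub_linear_le (hf : IsProfile c f) (hc : -1 < c) (w : ℝ) :
    |f w - (2 * (w + c) / (1 + c) - 1)| ≤ 2 := by
  have hp : 0 < 1 + c := by linarith
  refine forall_of_reflections hc (p := fun w => |f w - (2 * (w + c) / (1 + c) - 1)| ≤ 2)
    (fun w hw => ?_) (fun w hw => ?_) (fun w hw => ?_) w
  · have h1 := hf.mem_Icc hw
    have h2 : 0 ≤ 2 * (w + c) / (1 + c) := div_nonneg (by linarith [hw.1]) hp.le
    have h3 : 2 * (w + c) / (1 + c) ≤ 2 := by rw [div_le_iff₀ hp]; linarith [hw.2]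
    rw [abs_le]
    constructor <;> linarith [h1.1, h1.2]
  · rw [hf.refl_one, ← abs_neg]
    convert hw using 2
    field_simp
    ring
  · rw [hf.refl_neg, ← abs_neg]
    convert hw using 2
    field_simp
    ring

theorem tendsto_atTop (hf : IsProfile c f) (hc : -1 < c) : Tendsto f atTop atTop := by
  have hp : 0 < 1 + c := by linarith
  have h : Tendsto (fun w => 2 * (w + c) / (1 + c) + (-3)) atTop atTop :=
    tendsto_atTop_add_const_right _ _ (((tendsto_atTop_add_const_right _ _ tendsto_id).const_mul_atTop
      two_pos).atTop_div_const hp)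
  exact tendsto_atTop_mono (fun w => by linarith [(abs_le.1 (hf.abs_sub_linear_le hc w)).1]) h

theorem tendsto_atBot (hf : IsProfile c f) (hc : -1 < c) : Tendsto f atBot atBot := by
  have h := tendsto_atBot_add_const_left _ 2 (tendsto_neg_atTop_atBot.comp
    ((hf.tendsto_atTop hc).comp (tendsto_atTop_add_const_left _ 2 tendsto_neg_atBot_atTop)))
  refine h.congr fun w => ?_
  simp only [Function.comp]
  rw [show (2 : ℝ) + -w = 2 - w by ring, hf.refl_one]
  ring

theorem one_le_inv (hf : IsProfile c f) {w : ℝ} (h0 : 0 < w) (h1 : w ≤ 1) : 1 ≤ f w⁻¹ :=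
  hf.one ▸ hf.mono ((one_le_inv₀ h0).2 h1)

theorem inv_le_neg_one (hf : IsProfile c f) {w : ℝ} (h0 : w < 0) (h1 : -1 ≤ w) :
    f w⁻¹ ≤ -1 := by
  have : w⁻¹ ≤ -1 := by
    rw [inv_le_of_neg h0 (by norm_num)]; norm_num; exact h1
  exact hf.neg_one ▸ hf.mono this

theorem continuousAt_inv_inv (hf : IsProfile c f) (hc : -1 < c) {w : ℝ}
    (hw : w ∈ Set.Icc (-1) 1) : ContinuousAt (fun w => (f w⁻¹)⁻¹) w := by
  rcases lt_trichotomy w 0 with h0 | rfl | h0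
  · have := hf.inv_le_neg_one h0 hw.1
    exact (hf.cont.continuousAt.comp (continuousAt_inv₀ h0.ne)).inv₀ (by simp; linarith)
  · have hv : (f (0 : ℝ)⁻¹)⁻¹ = 0 := by rw [inv_zero, hf.zero, inv_zero]
    rw [continuousAt_iff_continuous_left'_right', ContinuousWithinAt, ContinuousWithinAt, hv]
    exact ⟨tendsto_inv_atBot_zero.comp ((hf.tendsto_atBot hc).comp tendsto_inv_nhdsLT_zero),
      tendsto_inv_atTop_zero.comp ((hf.tendsto_atTop hc).comp tendsto_inv_nhdsGT_zero)⟩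
  · have := hf.one_le_inv h0 hw.2
    exact (hf.cont.continuousAt.comp (continuousAt_inv₀ h0.ne')).inv₀ (by simp; linarith)

theorem monotoneOn_inv_inv (hf : IsProfile c f) :
    MonotoneOn (fun w => (f w⁻¹)⁻¹) (Set.Icc (-1) 1) := by
  have nonneg : ∀ w ∈ Set.Icc (-1 : ℝ) 1, 0 ≤ w → 0 ≤ (f w⁻¹)⁻¹ := fun w hw h0 => by
    rw [inv_nonneg, ← hf.zero]; exact hf.mono (inv_nonneg.2 h0)
  have nonpos : ∀ w ∈ Set.Icc (-1 : ℝ) 1, w ≤ 0 → (f w⁻¹)⁻¹ ≤ 0 := fun w hw h0 => by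
    rw [inv_nonpos, ← hf.zero]; exact hf.mono (inv_nonpos.2 h0)
  intro x hx y hy hxy
  change (f x⁻¹)⁻¹ ≤ (f y⁻¹)⁻¹
  rcases lt_or_ge 0 x with h0 | h0
  · have h1 := hf.one_le_inv (h0.trans_le hxy) hy.2
    exact inv_anti₀ (by linarith) (hf.mono (inv_anti₀ h0 hxy))
  rcases lt_or_ge y 0 with h1 | h1
  · have h2 := hf.inv_le_neg_one (hxy.trans_lt h1) hx.1
    have h3 := hf.inv_le_neg_one h1 hy.1
    exact (inv_le_inv_of_neg (by linarith) (by linarith)).2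
      (hf.mono ((inv_le_inv_of_neg h1 (hxy.trans_lt h1)).2 hxy))
  · exact (nonpos x hx h0).trans (nonneg y hy h1)

end IsProfile

/-! ### The contracting operator and its fixed point -/

/-- The retraction of the line onto `[-1, 1]`. -/
noncomputable def clamp (w : ℝ) : ℝ := max (-1) (min w 1)

theorem clamp_mem (w : ℝ) : clamp w ∈ Set.Icc (-1 : ℝ) 1 :=
  ⟨le_max_left _ _, max_le (by norm_num) (min_le_right _ _)⟩

theorem clamp_of_le {w : ℝ} (hw : w ≤ -1) : clamp w = -1 := by
  rw [clamp, min_eq_left (by linarith), max_eq_left hw]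

theorem clamp_of_ge {w : ℝ} (hw : 1 ≤ w) : clamp w = 1 := by
  rw [clamp, min_eq_right hw, max_eq_right (by norm_num)]

theorem clamp_of_mem {w : ℝ} (hw : w ∈ Set.Icc (-1 : ℝ) 1) : clamp w = w := by
  rw [clamp, min_eq_left hw.2, max_eq_right hw.1]

theorem monotone_clamp : Monotone clamp := fun _ _ h =>
  max_le_max le_rfl (min_le_min h le_rfl)

theorem continuous_clamp : Continuous clamp := by
  unfold clamp; fun_prop

/-- One step of the iteration: `f` is conjugated by the inversion `w ↦ w⁻¹` on `[-1, 1]`, set to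
`-1` on `[-c, -1]`, and extended by the two reflections. -/
noncomputable def inversionStep (c : ℝ) (f : ℝ → ℝ) : ℝ → ℝ :=
  dihedralExt c fun w => (f (clamp w)⁻¹)⁻¹

/-- The iterates of `inversionStep`, from the profile which is the identity on `[-1, 1]`. -/
noncomputable def profileSeq (c : ℝ) (n : ℕ) : ℝ → ℝ :=
  (inversionStep c)^[n] (dihedralExt c clamp)

namespace IsProfile

variable {c : ℝ} {f g : ℝ → ℝ}

theorem inversionStep_apply (hf : IsProfile c f) (hc : 1 < c) {w : ℝ} (hw : w ∈ Set.Icc (-c) 1) :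
    inversionStep c f w = (f (clamp w)⁻¹)⁻¹ :=
  dihedralExt_apply (by linarith)
    (fun w h => by simp only [clamp_of_ge h, inv_one, hf.one]) hw

theorem inversionStep (hf : IsProfile c f) (hc : 1 < c) : IsProfile c (inversionStep c f) := by
  refine isProfile_dihedralExt hc ?_ ?_ ?_ ?_ ?_
  · refine continuous_iff_continuousAt.2 fun w => ?_
    exact ContinuousAt.comp (f := clamp) (g := fun w => (f w⁻¹)⁻¹)
      (hf.continuousAt_inv_inv (by linarith) (clamp_mem w)) continuous_clamp.continuousAt
  · exact fun x y h => hf.monotoneOn_inv_inv (clamp_mem x) (clamp_mem y) (monotone_clamp h)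
  · intro w h
    rw [clamp_of_le h, inv_neg_one, hf.neg_one, inv_neg_one]
  · intro w h
    rw [clamp_of_ge h, inv_one, hf.one, inv_one]
  · rw [clamp_of_mem ⟨by norm_num, by norm_num⟩, inv_zero, hf.zero, inv_zero]

/-- Two profiles are uniformly close as soon as they are close on a fundamental domain. -/
theorem abs_sub_le (hf : IsProfile c f) (hg : IsProfile c g) (hc : -1 < c) {δ : ℝ}
    (h : ∀ w ∈ Set.Icc (-c) 1, |f w - g w| ≤ δ) (w : ℝ) : |f w - g w| ≤ δ := by
  refine forall_of_reflections hc h (fun w hw => ?_) (fun w hw => ?_) w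
  · rw [hf.refl_one, hg.refl_one, ← abs_neg]
    convert hw using 2
    ring
  · rw [hf.refl_neg, hg.refl_neg, ← abs_neg]
    convert hw using 2
    ring

theorem abs_sub_le_two (hf : IsProfile c f) (hg : IsProfile c g) (hc : -1 < c) (w : ℝ) :
    |f w - g w| ≤ 2 :=
  hf.abs_sub_le hg hc (fun w hw => abs_le.2
    ⟨by linarith [(hf.mem_Icc hw).1, (hg.mem_Icc hw).2],
      by linarith [(hf.mem_Icc hw).2, (hg.mem_Icc hw).1]⟩) w

end IsProfile

/-- Inversion moves points at distance at least `1` from `0` closer together. -/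
theorem abs_inv_sub_inv_le {x y δ : ℝ} (hx : 1 ≤ x) (hy : 1 ≤ y) (h : |x - y| ≤ δ) :
    |x⁻¹ - y⁻¹| ≤ δ / (1 + δ) := by
  wlog hxy : x ≤ y generalizing x y
  · rw [abs_sub_comm]
    exact this hy hx (by rwa [abs_sub_comm]) (le_of_not_ge hxy)
  have hx0 : 0 < x := by linarith
  have hy0 : 0 < y := by linarith
  rw [abs_sub_comm, abs_of_nonneg (by linarith)] at h
  have hδ : 0 ≤ δ := by linarith
  rw [abs_of_nonneg (sub_nonneg.2 (inv_anti₀ hx0 hxy)), inv_sub_inv hx0.ne' hy0.ne',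
    div_le_div_iff₀ (by positivity) (by positivity)]
  have h1 : x * y ≥ y := by nlinarith
  have h2 : (y - x) * (1 + δ) ≤ δ * (1 + (y - x)) := by nlinarith
  have h3 : 1 + (y - x) ≤ x * y := by nlinarith
  nlinarith

namespace IsProfile

variable {c : ℝ} {f g : ℝ → ℝ}

theorem abs_inversionStep_sub_le (hf : IsProfile c f) (hg : IsProfile c g) (hc : 1 < c) {δ : ℝ}
    (h : ∀ w, |f w - g w| ≤ δ) (w : ℝ) :
    |VeechRays.inversionStep c f w - VeechRays.inversionStep c g w| ≤ δ / (1 + δ) := by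
  refine (hf.inversionStep hc).abs_sub_le (hg.inversionStep hc) (by linarith) (fun w hw => ?_) w
  rw [hf.inversionStep_apply hc hw, hg.inversionStep_apply hc hw]
  have hδ : 0 ≤ δ := (abs_nonneg _).trans (h 0)
  have hv := clamp_mem w
  generalize clamp w = v at hv
  rcases lt_trichotomy v 0 with h0 | rfl | h0
  · have h1 := hf.inv_le_neg_one h0 hv.1
    have h2 := hg.inv_le_neg_one h0 hv.1
    have := abs_inv_sub_inv_le (x := -f v⁻¹) (y := -g v⁻¹) (δ := δ) (by linarith) (by linarith)
      (by rw [← abs_neg]; convert h v⁻¹ using 2; ring)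
    rw [← abs_neg]
    convert this using 2
    rw [inv_neg, inv_neg]
    ring
  · rw [inv_zero, hf.zero, hg.zero, sub_self, abs_zero]
    positivity
  · exact abs_inv_sub_inv_le (hf.one_le_inv h0 hv.2) (hg.one_le_inv h0 hv.2) (h _)

end IsProfile

section Limit

variable {c : ℝ}

theorem profileSeq_succ (n : ℕ) : profileSeq c (n + 1) = inversionStep c (profileSeq c n) :=
  Function.iterate_succ_apply' _ _ _

theorem isProfile_profileSeq (hc : 1 < c) (n : ℕ) : IsProfile c (profileSeq c n) := by
  induction n with
  | zero =>
    exact isProfile_dihedralExt hc continuous_clamp monotone_clamp (fun _ => clamp_of_le)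
      (fun _ => clamp_of_ge) (clamp_of_mem ⟨by norm_num, by norm_num⟩)
  | succ n ih => rw [profileSeq_succ]; exact ih.inversionStep hc

/-- The `n`-th iterate of `δ ↦ δ / (1 + δ)` at `2` is `2 / (1 + 2 * n)`. -/
theorem abs_profileSeq_sub_le (hc : 1 < c) (n k : ℕ) (w : ℝ) :
    |profileSeq c n w - profileSeq c (n + k) w| ≤ 2 / (1 + 2 * n) := by
  induction n generalizing w with
  | zero =>
    simpa using (isProfile_profileSeq hc 0).abs_sub_le_two (isProfile_profileSeq hc (0 + k))
      (by linarith) w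
  | succ n ih =>
    rw [add_right_comm, profileSeq_succ, profileSeq_succ]
    refine ((isProfile_profileSeq hc n).abs_inversionStep_sub_le (isProfile_profileSeq hc (n + k))
      hc ih w).trans_eq ?_
    push_cast
    field_simp
    ring

theorem exists_tendstoUniformly_profileSeq (hc : 1 < c) :
    ∃ f : ℝ → ℝ, TendstoUniformly (profileSeq c) f atTop := by
  have h0 : Tendsto (fun n : ℕ => 2 / (1 + 2 * (n : ℝ))) atTop (𝓝 0) :=
    (tendsto_atTop_add_const_left _ 1
      (tendsto_natCast_atTop_atTop.const_mul_atTop two_pos)).const_div_atTop 2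
  have hC : ∀ w, CauchySeq fun n => profileSeq c n w := fun w => by
    refine cauchySeq_of_le_tendsto_0' _ (fun n m hnm => ?_) h0
    obtain ⟨k, rfl⟩ := Nat.exists_eq_add_of_le hnm
    exact abs_profileSeq_sub_le hc n k w
  choose f hf using fun w => cauchySeq_tendsto_of_complete (hC w)
  refine ⟨f, Metric.tendstoUniformly_iff.2 fun ε hε => ?_⟩
  filter_upwards [h0.eventually (gt_mem_nhds hε)] with n hn w
  refine lt_of_le_of_lt ?_ hn
  have h1 : Tendsto (fun k => |profileSeq c n w - profileSeq c (n + k) w|) atTop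
      (𝓝 |profileSeq c n w - f w|) := by
    have := (hf w).comp (tendsto_add_atTop_nat n)
    simp only [Function.comp_def, add_comm _ n] at this
    exact (this.const_sub _).abs
  rw [dist_comm, Real.dist_eq]
  exact le_of_tendsto' h1 fun k => abs_profileSeq_sub_le hc n k w

/-- The fixed point of `inversionStep`: a profile which also commutes with inversion. With
`0⁻¹ = 0` the last equation holds at `0` because `f 0 = 0`. -/
theorem exists_isProfile_inv (hc : 1 < c) :
    ∃ f : ℝ → ℝ, IsProfile c f ∧ ∀ w, f w⁻¹ = (f w)⁻¹ := by
  obtain ⟨f, hu⟩ := exists_tendstoUniformly_profileSeq hc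
  have hS := isProfile_profileSeq hc
  have ht : ∀ w, Tendsto (fun n => profileSeq c n w) atTop (𝓝 (f w)) := fun w => hu.tendsto_at w
  have hf : IsProfile c f :=
    { mono := fun x y h => le_of_tendsto_of_tendsto' (ht x) (ht y) fun n => (hS n).mono h
      cont := hu.continuous (Eventually.of_forall fun n => (hS n).cont).frequently
      refl_one := fun w => tendsto_nhds_unique (ht _)
        (((ht w).const_sub 2).congr fun n => ((hS n).refl_one w).symm)
      refl_neg := fun w => tendsto_nhds_unique (ht _)
        (((ht w).const_sub (-2)).congr fun n => ((hS n).refl_neg w).symm)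
      neg_one := tendsto_nhds_unique (ht _)
        (tendsto_const_nhds.congr fun n => (hS n).neg_one.symm)
      zero := tendsto_nhds_unique (ht _) (tendsto_const_nhds.congr fun n => (hS n).zero.symm) }
  have key : ∀ w ∈ Set.Icc (-1 : ℝ) 1, f w = (f w⁻¹)⁻¹ := fun w hw => by
    rcases eq_or_ne w 0 with rfl | h0
    · rw [inv_zero, hf.zero, inv_zero]
    have hne : f w⁻¹ ≠ 0 := by
      rcases h0.lt_or_gt with h | h
      · linarith [hf.inv_le_neg_one h hw.1]
      · linarith [hf.one_le_inv h hw.2]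
    refine tendsto_nhds_unique ((ht w).comp (tendsto_add_atTop_nat 1))
      (((ht w⁻¹).inv₀ hne).congr fun n => ?_)
    simp only [Function.comp]
    rw [profileSeq_succ, (hS n).inversionStep_apply hc ⟨by linarith [hw.1], hw.2⟩, clamp_of_mem hw]
  refine ⟨f, hf, fun w => ?_⟩
  by_cases hw : w ∈ Set.Icc (-1 : ℝ) 1
  · rw [key w hw, inv_inv]
  · have : w⁻¹ ∈ Set.Icc (-1 : ℝ) 1 := by
      rw [Set.mem_Icc, ← abs_le, abs_inv]
      rw [Set.mem_Icc, ← abs_le, not_le] at hw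
      exact inv_le_one_of_one_le₀ hw.le
    rw [key _ this, inv_inv]

end Limit

/-! ### From maps of slopes to maps of rays -/

/-- A continuous non-decreasing map of the inverse slopes `u = x / y` which intertwines the
reflections induced by `A` and `B` with themselves. -/
structure IsSlopeMap (g : ℝ → ℝ) : Prop where
  mono : Monotone g
  cont : Continuous g
  odd : ∀ u, g (-u) = -g u
  refl : ∀ u, g (2 - u) = 2 - g u
  abs_sub_le : ∀ u, |g u - u| ≤ 1

theorem IsSlopeMap.zero {g : ℝ → ℝ} (hg : IsSlopeMap g) : g 0 = 0 := by
  have := hg.odd 0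
  rw [neg_zero] at this
  linarith

theorem IsSlopeMap.one {g : ℝ → ℝ} (hg : IsSlopeMap g) : g 1 = 1 := by
  have := hg.refl 1
  norm_num at this
  linarith

/-- A profile is a map of inverse slopes, read in the affine coordinates `w = (c + 1) u - c` on the
source and `2 u - 1` on the target. In these coordinates `C_c` and `C_1` are both inversions. -/
theorem IsProfile.isSlopeMap {c : ℝ} {f : ℝ → ℝ} (hf : IsProfile c f) (hc : -1 < c) :
    IsSlopeMap fun u => (1 + f ((c + 1) * u - c)) / 2 where
  mono := fun u v h => by
    have h1 : (c + 1) * u - c ≤ (c + 1) * v - c := by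
      have : 0 < c + 1 := by linarith
      gcongr
    have := hf.mono h1
    change (1 + f _) / 2 ≤ (1 + f _) / 2
    linarith
  cont := by
    have := hf.cont
    fun_prop
  odd := fun u => by
    rw [show (c + 1) * -u - c = -2 * c - ((c + 1) * u - c) by ring, hf.refl_neg]
    ring
  refl := fun u => by
    rw [show (c + 1) * (2 - u) - c = 2 - ((c + 1) * u - c) by ring, hf.refl_one]
    ring
  abs_sub_le := fun u => by
    have h := hf.abs_sub_linear_le hc ((c + 1) * u - c)
    have e : 2 * ((c + 1) * u - c + c) / (1 + c) = 2 * u := by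
      have : 0 < 1 + c := by linarith
      field_simp; ring
    rw [e, abs_le] at h
    rw [abs_le]
    constructor <;> linarith [h.1, h.2]

/-- The homogeneous map of the plane which preserves the height `y` and acts on inverse slopes by
`g`. It is `(x, y) ↦ (y * g (x / y), y)`, extended by the identity to `y = 0`, written in a way in
which the division by zero does no harm. -/
noncomputable def planeMap (g : ℝ → ℝ) (v : Fin 2 → ℝ) : Fin 2 → ℝ :=
  ![v 0 + v 1 * (g (v 0 / v 1) - v 0 / v 1), v 1]

section planeMap

variable {g : ℝ → ℝ}

theorem planeMap_of_ne (x : ℝ) {y : ℝ} (hy : y ≠ 0) :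
    planeMap g ![x, y] = ![y * g (x / y), y] := by
  ext i
  fin_cases i
  · simp only [planeMap, Fin.zero_eta, Matrix.cons_val_zero, Matrix.cons_val_one]
    field_simp
    ring
  · rfl

theorem planeMap_zero (x : ℝ) : planeMap g ![x, 0] = ![x, 0] := by
  simp [planeMap]

theorem eq_vec (v : Fin 2 → ℝ) : v = ![v 0, v 1] := by
  ext i; fin_cases i <;> rfl

theorem planeMap_smul {t : ℝ} (ht : t ≠ 0) (v : Fin 2 → ℝ) :
    planeMap g (t • v) = t • planeMap g v := by
  ext i
  fin_cases i
  · simp [planeMap, mul_div_mul_left _ _ ht]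
    ring
  · rfl

theorem planeMap_ne_zero {v : Fin 2 → ℝ} (hv : v ≠ 0) : planeMap g v ≠ 0 := by
  intro h
  have h1 : v 1 = 0 := congrFun h 1
  have h0 := congrFun h 0
  simp only [planeMap, h1] at h0
  apply hv
  ext i
  fin_cases i
  · simpa using h0
  · exact h1

theorem sameRay_planeMap {v w : Fin 2 → ℝ} (hv : v ≠ 0) (hw : w ≠ 0) (h : SameRay ℝ v w) :
    SameRay ℝ (planeMap g v) (planeMap g w) := by
  obtain ⟨t, ht, rfl⟩ := h.exists_pos_left hv hw
  rw [planeMap_smul ht.ne']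
  exact SameRay.sameRay_pos_smul_right _ ht

theorem continuous_planeMap (hg : IsSlopeMap g) : Continuous (planeMap g) := by
  have h1 : Continuous fun v : Fin 2 → ℝ => v 1 * (g (v 0 / v 1) - v 0 / v 1) := by
    refine continuous_iff_continuousAt.2 fun v => ?_
    by_cases hv : v 1 = 0
    · -- the second factor is bounded
      rw [ContinuousAt, hv, zero_mul]
      have h0 : Tendsto (fun v : Fin 2 → ℝ => |v 1|) (𝓝 v) (𝓝 0) := by
        have : Continuous fun v : Fin 2 → ℝ => |v 1| := by fun_prop
        simpa [hv] using this.tendsto v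
      refine squeeze_zero_norm (fun w => ?_) h0
      rw [Real.norm_eq_abs, abs_mul]
      exact mul_le_of_le_one_right (abs_nonneg _) (hg.abs_sub_le _)
    · have hd : ContinuousAt (fun v : Fin 2 → ℝ => v 0 / v 1) v :=
        (continuous_apply 0).continuousAt.div (continuous_apply 1).continuousAt hv
      exact (continuous_apply 1).continuousAt.mul
        ((ContinuousAt.comp (g := g) hg.cont.continuousAt hd).sub hd)
  refine continuous_pi fun i => ?_
  fin_cases i
  · exact (continuous_apply 0).add h1
  · exact continuous_apply 1

end planeMap

/-- The map of the circle of rays induced by `planeMap g`. -/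
noncomputable def rayMap (g : ℝ → ℝ) (r : Circ) : Circ :=
  rayOfNeZero ℝ (planeMap g r.someVector) (planeMap_ne_zero r.someVector_ne_zero)

section rayMap

variable {g : ℝ → ℝ}

theorem rayMap_rayOfNeZero {v : Fin 2 → ℝ} (hv : v ≠ 0) :
    rayMap g (rayOfNeZero ℝ v hv) = rayOfNeZero ℝ (planeMap g v) (planeMap_ne_zero hv) := by
  refine (ray_eq_iff _ _).2 (sameRay_planeMap (Module.Ray.someVector_ne_zero _) hv ?_)
  exact (ray_eq_iff (Module.Ray.someVector_ne_zero _) hv).1 (Module.Ray.someVector_ray _)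

theorem rayMap_neg (r : Circ) : rayMap g (-r) = -rayMap g r := by
  induction r using Module.Ray.ind with
  | h v hv =>
    rw [neg_rayOfNeZero, rayMap_rayOfNeZero, rayMap_rayOfNeZero, neg_rayOfNeZero]
    congr 1
    simpa using planeMap_smul (g := g) (neg_ne_zero.2 one_ne_zero) v

theorem continuous_rayMap (hg : IsSlopeMap g) : Continuous (rayMap g) := by
  refine continuous_coinduced_dom.2 ?_
  have h1 : Continuous fun v : {v : Fin 2 → ℝ // v ≠ 0} =>
      (⟨planeMap g v.1, planeMap_ne_zero v.2⟩ : {v : Fin 2 → ℝ // v ≠ 0}) :=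
    ((continuous_planeMap hg).comp continuous_subtype_val).subtype_mk _
  have h2 : Continuous fun v : {v : Fin 2 → ℝ // v ≠ 0} => rayOfNeZero ℝ v.1 v.2 :=
    continuous_coinduced_rng
  convert h2.comp h1 using 1
  funext v
  exact rayMap_rayOfNeZero v.2

theorem rayMap_horizontalRay : rayMap g horizontalRay = horizontalRay := by
  rw [horizontalRay, rayMap_rayOfNeZero]
  congr 1
  exact planeMap_zero 1

theorem rayMap_slopeOneRay (hg : IsSlopeMap g) : rayMap g slopeOneRay = slopeOneRay := by
  rw [slopeOneRay, rayMap_rayOfNeZero]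
  congr 1
  rw [planeMap_of_ne 1 one_ne_zero, div_one, hg.one, mul_one]

end rayMap

/-! ### The lift to the universal cover -/

/-- The first coordinate of the image of the unit vector at angle `t` under `planeMap g`. -/
noncomputable def imageX (g : ℝ → ℝ) (t : ℝ) : ℝ :=
  planeMap g ![Real.cos t, Real.sin t] 0

/-- The inner product of the unit vector at angle `t` with its image under `planeMap g`. -/
noncomputable def imageInner (g : ℝ → ℝ) (t : ℝ) : ℝ :=
  Real.cos t * imageX g t + Real.sin t ^ 2

/-- The lift of `rayMap g`: the angle of the image is the sum of `t` and of the oriented angle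
between a vector and its image, which is acute. -/
noncomputable def angleMap (g : ℝ → ℝ) (t : ℝ) : ℝ :=
  t + Real.arctan (Real.sin t * (Real.cos t - imageX g t) / imageInner g t)

section angleMap

variable {g : ℝ → ℝ}

theorem planeMap_dir (t : ℝ) :
    planeMap g ![Real.cos t, Real.sin t] = ![imageX g t, Real.sin t] := by
  ext i; fin_cases i <;> rfl

theorem imageX_of_ne {t : ℝ} (h : Real.sin t ≠ 0) :
    imageX g t = Real.sin t * g (Real.cos t / Real.sin t) := by
  rw [imageX, planeMap_of_ne _ h]; rfl

theorem imageX_of_eq {t : ℝ} (h : Real.sin t = 0) : imageX g t = Real.cos t := by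
  rw [imageX, h, planeMap_zero]; rfl

theorem imageX_add_pi (t : ℝ) : imageX g (t + Real.pi) = -imageX g t := by
  have := planeMap_smul (g := g) (neg_ne_zero.2 one_ne_zero) ![Real.cos t, Real.sin t]
  have e : (-1 : ℝ) • ![Real.cos t, Real.sin t] = ![-Real.cos t, -Real.sin t] := by simp
  rw [e] at this
  rw [imageX, Real.cos_add_pi, Real.sin_add_pi, this]
  simp [imageX]

theorem imageInner_pos (hg : IsSlopeMap g) (t : ℝ) : 0 < imageInner g t := by
  by_cases h : Real.sin t = 0
  · have := Real.sin_sq_add_cos_sq t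
    rw [imageInner, imageX_of_eq h]
    nlinarith
  · -- `g` preserves signs
    have h1 : 0 ≤ Real.cos t / Real.sin t * g (Real.cos t / Real.sin t) := by
      rcases le_total 0 (Real.cos t / Real.sin t) with h0 | h0
      · exact mul_nonneg h0 (hg.zero ▸ hg.mono h0)
      · exact mul_nonneg_of_nonpos_of_nonpos h0 (hg.zero ▸ hg.mono h0)
    have h2 : Real.cos t * imageX g t =
        Real.sin t ^ 2 * (Real.cos t / Real.sin t * g (Real.cos t / Real.sin t)) := by
      rw [imageX_of_ne h]; field_simp
    rw [imageInner, h2]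
    have : 0 < Real.sin t ^ 2 := by positivity
    nlinarith [mul_nonneg this.le h1]

theorem continuous_imageX (hg : IsSlopeMap g) : Continuous (imageX g) := by
  have h := continuous_planeMap hg
  have h2 : Continuous fun t : ℝ => ![Real.cos t, Real.sin t] := by
    refine continuous_pi fun i => ?_
    fin_cases i
    · exact Real.continuous_cos
    · exact Real.continuous_sin
  exact (continuous_apply 0).comp (h.comp h2)

theorem continuous_angleMap (hg : IsSlopeMap g) : Continuous (angleMap g) := by
  have h := continuous_imageX hg
  have h1 : Continuous (imageInner g) := by unfold imageInner; fun_prop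
  have h2 : Continuous fun t =>
      Real.sin t * (Real.cos t - imageX g t) / imageInner g t :=
    Continuous.div (by fun_prop) h1 fun t => (imageInner_pos hg t).ne'
  exact continuous_id.add (Real.continuous_arctan.comp h2)

theorem angleMap_add_pi (t : ℝ) : angleMap g (t + Real.pi) = angleMap g t + Real.pi := by
  have h1 : imageInner g (t + Real.pi) = imageInner g t := by
    simp only [imageInner, imageX_add_pi, Real.cos_add_pi, Real.sin_add_pi]; ring
  have h2 : Real.sin (t + Real.pi) * (Real.cos (t + Real.pi) - imageX g (t + Real.pi)) =
      Real.sin t * (Real.cos t - imageX g t) := by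
    simp only [imageX_add_pi, Real.cos_add_pi, Real.sin_add_pi]; ring
  rw [angleMap, angleMap, h1, h2]
  ring

theorem angleMap_zero : angleMap g 0 = 0 := by simp [angleMap]

/-- The angle `angleMap g t` is that of the image of the unit vector at angle `t`. -/
theorem exists_pos_cos_sin_angleMap (hg : IsSlopeMap g) (t : ℝ) :
    ∃ ρ > 0, imageX g t = ρ * Real.cos (angleMap g t) ∧
      Real.sin t = ρ * Real.sin (angleMap g t) := by
  have hI := imageInner_pos hg t
  have hT := Real.sin_sq_add_cos_sq t
  set q := Real.sin t * (Real.cos t - imageX g t) / imageInner g t with hq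
  have hqI : q * imageInner g t = Real.sin t * (Real.cos t - imageX g t) :=
    div_mul_cancel₀ _ hI.ne'
  have hs : 0 < √(1 + q ^ 2) := Real.sqrt_pos.2 (by positivity)
  have hII : imageInner g t = Real.cos t * imageX g t + Real.sin t ^ 2 := rfl
  refine ⟨imageInner g t * √(1 + q ^ 2), by positivity, ?_, ?_⟩
  · rw [angleMap, ← hq, Real.cos_add, Real.cos_arctan, Real.sin_arctan]
    field_simp
    linear_combination (-(imageX g t)) * hT + Real.sin t * hqI - Real.cos t * hII
  · rw [angleMap, ← hq, Real.sin_add, Real.cos_arctan, Real.sin_arctan]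
    field_simp
    linear_combination (-(Real.sin t)) * hT - Real.cos t * hqI - Real.sin t * hII

theorem rayMap_rayAt (hg : IsSlopeMap g) (t : ℝ) : rayMap g (rayAt t) = rayAt (angleMap g t) := by
  obtain ⟨ρ, hρ, h1, h2⟩ := exists_pos_cos_sin_angleMap hg t
  rw [rayAt, rayAt, rayMap_rayOfNeZero, ray_eq_iff, planeMap_dir]
  rw [h1, h2]
  convert SameRay.sameRay_pos_smul_left (R := ℝ) (M := Fin 2 → ℝ)
    ![Real.cos (angleMap g t), Real.sin (angleMap g t)] hρ using 1
  simp

theorem angleMap_mem_Ioo (hg : IsSlopeMap g) {t : ℝ} (ht : t ∈ Set.Ioo 0 Real.pi) :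
    angleMap g t ∈ Set.Ioo 0 Real.pi := by
  obtain ⟨ρ, hρ, -, h2⟩ := exists_pos_cos_sin_angleMap hg t
  have hs : 0 < Real.sin (angleMap g t) :=
    pos_of_mul_pos_right (h2 ▸ Real.sin_pos_of_mem_Ioo ht) hρ.le
  have h3 := Real.neg_pi_div_two_lt_arctan
    (Real.sin t * (Real.cos t - imageX g t) / imageInner g t)
  have h4 := Real.arctan_lt_pi_div_two
    (Real.sin t * (Real.cos t - imageX g t) / imageInner g t)
  have h5 : -(Real.pi / 2) < angleMap g t := by rw [angleMap]; linarith [ht.1]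
  have h6 : angleMap g t < 2 * Real.pi := by rw [angleMap]; linarith [ht.2]
  constructor
  · by_contra! h
    linarith [Real.sin_nonpos_of_nonpos_of_neg_pi_le h (by linarith)]
  · by_contra! h
    have := Real.sin_nonneg_of_nonneg_of_le_pi (x := angleMap g t - Real.pi) (by linarith)
      (by linarith)
    rw [Real.sin_sub_pi] at this
    linarith

theorem monotoneOn_angleMap (hg : IsSlopeMap g) :
    MonotoneOn (angleMap g) (Set.Ico 0 Real.pi) := by
  intro s hs t ht hst
  have nonneg : ∀ t ∈ Set.Ico 0 Real.pi, 0 ≤ angleMap g t := fun t ht => by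
    rcases ht.1.eq_or_lt with rfl | h
    · exact angleMap_zero.ge
    · exact (angleMap_mem_Ioo hg ⟨h, ht.2⟩).1.le
  rcases hs.1.eq_or_lt with rfl | hs0
  · rw [angleMap_zero]; exact nonneg t ht
  have hs' : s ∈ Set.Ioo 0 Real.pi := ⟨hs0, hs.2⟩
  have ht' : t ∈ Set.Ioo 0 Real.pi := ⟨hs0.trans_le hst, ht.2⟩
  have ps := Real.sin_pos_of_mem_Ioo hs'
  have pt := Real.sin_pos_of_mem_Ioo ht'
  have hu : Real.cos t / Real.sin t ≤ Real.cos s / Real.sin s := by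
    rw [div_le_div_iff₀ pt ps]
    have := Real.sin_nonneg_of_nonneg_of_le_pi (x := t - s) (by linarith)
      (by linarith [ht.2, hs.1])
    rw [Real.sin_sub] at this
    linarith
  obtain ⟨ρ, hρ, h1, h2⟩ := exists_pos_cos_sin_angleMap hg s
  obtain ⟨σ, hσ, h3, h4⟩ := exists_pos_cos_sin_angleMap hg t
  by_contra! h
  -- the two images span a parallelogram whose oriented area contradicts the monotonicity of `g`
  have h5 : 0 < Real.sin (angleMap g s - angleMap g t) :=
    Real.sin_pos_of_pos_of_lt_pi (by linarith)
      (by linarith [(angleMap_mem_Ioo hg hs').2, (angleMap_mem_Ioo hg ht').1])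
  have h6 : ρ * σ * Real.sin (angleMap g s - angleMap g t) =
      Real.sin s * imageX g t - imageX g s * Real.sin t := by
    rw [h1, h2, h3, h4, Real.sin_sub]; ring
  rw [imageX_of_ne ps.ne', imageX_of_ne pt.ne'] at h6
  have h7 : 0 < ρ * σ * Real.sin (angleMap g s - angleMap g t) := by positivity
  have h8 := mul_le_mul_of_nonneg_left (hg.mono hu) (mul_pos ps pt).le
  linarith

theorem monotone_angleMap (hg : IsSlopeMap g) : Monotone (angleMap g) := by
  have hp : Function.Periodic (fun t => angleMap g t - t) Real.pi := fun t => by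
    simp only [angleMap_add_pi]; ring
  have hn : ∀ (n : ℤ) t, angleMap g (t + n * Real.pi) = angleMap g t + n * Real.pi := fun n t => by
    have := hp.int_mul n t
    linarith
  -- every point is of the form `t + n π` with `t` in `[0, π)`
  have dec : ∀ x : ℝ, ∃ n : ℤ, ∃ t ∈ Set.Ico 0 Real.pi, x = t + n * Real.pi := fun x =>
    ⟨toIcoDiv Real.pi_pos 0 x, toIcoMod Real.pi_pos 0 x,
      by simpa using toIcoMod_mem_Ico Real.pi_pos 0 x,
      by simp⟩
  intro x y hxy
  obtain ⟨m, s, hs, rfl⟩ := dec x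
  obtain ⟨n, t, ht, rfl⟩ := dec y
  have hpi := Real.pi_pos
  rw [hn, hn]
  have hm0 := monotoneOn_angleMap hg
  rcases lt_trichotomy m n with h | rfl | h
  · have h' : (m : ℝ) + 1 ≤ n := by exact_mod_cast h
    have h1 : angleMap g s ≤ Real.pi := by
      rcases hs.1.eq_or_lt with rfl | h0
      · rw [angleMap_zero]; exact hpi.le
      · exact (angleMap_mem_Ioo hg ⟨h0, hs.2⟩).2.le
    have h2 := hm0 ⟨le_rfl, hpi⟩ ht ht.1
    rw [angleMap_zero] at h2
    nlinarith
  · have := hm0 hs ht (by linarith)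
    linarith
  · have h' : (n : ℝ) + 1 ≤ m := by exact_mod_cast h
    nlinarith [hs.1, ht.2]

theorem isMonotoneDegreeOne_rayMap (hg : IsSlopeMap g) : IsMonotoneDegreeOne (rayMap g) :=
  ⟨angleMap g, continuous_angleMap hg, monotone_angleMap hg,
    fun t => by
      rw [show t + 2 * Real.pi = t + Real.pi + Real.pi by ring, angleMap_add_pi, angleMap_add_pi]
      ring,
    rayMap_rayAt hg⟩

end angleMap

/-! ### Equivariance -/

section Equivariance

open Matrix

theorem mulVec_ne_zero (M : GL (Fin 2) ℝ) {v : Fin 2 → ℝ} (hv : v ≠ 0) : M.1 *ᵥ v ≠ 0 :=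
  fun h => hv <| by
    rw [← Matrix.one_mulVec v, ← Units.inv_mul M, ← Matrix.mulVec_mulVec, h, Matrix.mulVec_zero]

theorem rayAct_rayOfNeZero (M : GL (Fin 2) ℝ) {v : Fin 2 → ℝ} (hv : v ≠ 0) :
    rayAct M (rayOfNeZero ℝ v hv) = rayOfNeZero ℝ (M.1 *ᵥ v) (mulVec_ne_zero M hv) := by
  rw [rayAct, Module.Ray.map_apply]
  rfl

theorem rayAct_mul (M N : GL (Fin 2) ℝ) (r : Circ) : rayAct (M * N) r = rayAct M (rayAct N r) := by
  induction r using Module.Ray.ind with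
  | h v hv =>
    simp only [rayAct_rayOfNeZero]
    congr 1
    exact (Matrix.mulVec_mulVec v M.1 N.1).symm

theorem rayAct_one (r : Circ) : rayAct 1 r = r := by
  induction r using Module.Ray.ind with
  | h v hv =>
    rw [rayAct_rayOfNeZero]
    congr 1
    exact Matrix.one_mulVec v

theorem rayAct_neg_one (r : Circ) : rayAct (-1) r = -r := by
  induction r using Module.Ray.ind with
  | h v hv =>
    rw [rayAct_rayOfNeZero, neg_rayOfNeZero]
    congr 1
    rw [Units.val_neg, Units.val_one, Matrix.neg_mulVec, Matrix.one_mulVec]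

theorem matA_mulVec (x y : ℝ) : matA *ᵥ ![x, y] = ![-x, y] := by
  ext i; fin_cases i <;> simp [matA, Matrix.mulVec, dotProduct]

theorem matB_mulVec (x y : ℝ) : matB *ᵥ ![x, y] = ![2 * y - x, y] := by
  ext i; fin_cases i <;> (simp [matB, Matrix.mulVec, dotProduct]; try ring)

theorem matC_mulVec (c x y : ℝ) :
    matC c *ᵥ ![x, y] = ![(c - 1) * y - c * x, -((c + 1) * x - c * y)] := by
  ext i; fin_cases i <;> simp [matC, Matrix.mulVec, dotProduct] <;> ring

theorem planeMap_matA {g : ℝ → ℝ} (hg : IsSlopeMap g) (v : Fin 2 → ℝ) :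
    planeMap g (matA *ᵥ v) = matA *ᵥ planeMap g v := by
  rw [eq_vec v, matA_mulVec]
  by_cases hy : v 1 = 0
  · rw [hy, planeMap_zero, planeMap_zero, matA_mulVec]
  · rw [planeMap_of_ne _ hy, planeMap_of_ne _ hy, matA_mulVec, neg_div, hg.odd, mul_neg]

theorem planeMap_matB {g : ℝ → ℝ} (hg : IsSlopeMap g) (v : Fin 2 → ℝ) :
    planeMap g (matB *ᵥ v) = matB *ᵥ planeMap g v := by
  rw [eq_vec v, matB_mulVec]
  by_cases hy : v 1 = 0
  · rw [hy, planeMap_zero, planeMap_zero, matB_mulVec, mul_zero]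
  · rw [planeMap_of_ne _ hy, planeMap_of_ne _ hy, matB_mulVec, sub_div, mul_div_cancel_right₀ _ hy,
      hg.refl]
    congr 1
    ring

/-- The reflections `C_c` and `C_1` are intertwined up to a positive factor, which is `w / f w` on
a line of coordinate `w = (c + 1) x / y - c` other than `0` and `∞`. -/
theorem sameRay_planeMap_matC {c : ℝ} (hc : 1 < c) {f : ℝ → ℝ} (hf : IsProfile c f)
    (hinv : ∀ w, f w⁻¹ = (f w)⁻¹) (v : Fin 2 → ℝ) :
    SameRay ℝ (planeMap (fun u => (1 + f ((c + 1) * u - c)) / 2) (matC c *ᵥ v))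
      (matC 1 *ᵥ planeMap (fun u => (1 + f ((c + 1) * u - c)) / 2) v) := by
  have hc1 : 0 < c + 1 := by linarith
  set g : ℝ → ℝ := fun u => (1 + f ((c + 1) * u - c)) / 2 with hgdef
  rw [eq_vec v, matC_mulVec]
  generalize v 0 = x
  generalize v 1 = y
  -- the value of `g` at the image is `(1 + f (y / ξ)) / 2`, where `ξ = (c + 1) x - c y`
  by_cases hξ : (c + 1) * x - c * y = 0
  · rw [hξ, neg_zero, planeMap_zero]
    by_cases hy : y = 0
    · subst hy
      have hx : x = 0 := by simpa [hc1.ne'] using hξ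
      subst hx
      have h0 : (![0, 0] : Fin 2 → ℝ) = 0 := by simp
      rw [show (c - 1) * 0 - c * 0 = 0 by ring, h0]
      exact SameRay.zero_left _
    · have hg : g (x / y) = 1 / 2 := by
        have : (c + 1) * (x / y) - c = 0 := by field_simp; linarith
        simp only [hgdef, this, hf.zero]; norm_num
      rw [planeMap_of_ne _ hy, hg, matC_mulVec]
      convert SameRay.sameRay_pos_smul_left (R := ℝ) (M := Fin 2 → ℝ) _
        (show 0 < 2 / (c + 1) by positivity) using 1
      ext i
      fin_cases i
      · simp
        field_simp
        linear_combination (-c) * hξ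
      · simp
        right; ring
  by_cases hy : y = 0
  · subst hy
    have hx : x ≠ 0 := fun h => hξ (by rw [h]; ring)
    have hg : g (((c - 1) * 0 - c * x) / (-((c + 1) * x - c * 0))) = 1 / 2 := by
      have : (c + 1) * (((c - 1) * 0 - c * x) / (-((c + 1) * x - c * 0))) - c = 0 := by
        field_simp; ring
      simp only [hgdef, this, hf.zero]; norm_num
    rw [planeMap_of_ne _ (neg_ne_zero.2 hξ), hg, planeMap_zero, matC_mulVec]
    convert SameRay.sameRay_pos_smul_left (R := ℝ) (M := Fin 2 → ℝ) _
      (show 0 < (c + 1) / 2 by positivity) using 1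
    ext i
    fin_cases i
    · simp; ring
    · simp; ring
  · obtain ⟨w, hw⟩ : ∃ w, w = (c + 1) * (x / y) - c := ⟨_, rfl⟩
    have hwy : (c + 1) * x - c * y = w * y := by rw [hw]; field_simp
    have hw0 : w ≠ 0 := fun h => hξ (by rw [hwy, h, zero_mul])
    have hpos : 0 < w * f w := by
      have hne : ∀ w, 1 ≤ |w| → f w ≠ 0 := fun w h => by
        rcases le_abs.1 h with h | h
        · linarith [hf.one ▸ hf.mono h]
        · have h' : w ≤ -1 := by linarith
          linarith [hf.neg_one ▸ hf.mono h']
      have hfw : f w ≠ 0 := by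
        rcases le_total 1 |w| with h | h
        · exact hne w h
        · have h1 : f w⁻¹ ≠ 0 := hne _ (by
            rw [abs_inv]; exact (one_le_inv₀ (abs_pos.2 hw0)).2 h)
          rw [hinv] at h1
          exact fun h2 => h1 (by rw [h2, _root_.inv_zero])
      rcases hw0.lt_or_gt with h | h
      · exact mul_pos_of_neg_of_neg h (lt_of_le_of_ne (hf.zero ▸ hf.mono h.le) hfw)
      · exact mul_pos h (lt_of_le_of_ne (hf.zero ▸ hf.mono h.le) hfw.symm)
    have hfw : f w ≠ 0 := right_ne_zero_of_mul hpos.ne'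
    have hdiv : 0 < w / f w := by
      have : w / f w = w * f w / f w ^ 2 := by field_simp
      rw [this]; positivity
    have hg1 : g (x / y) = (1 + f w) / 2 := by simp only [hgdef, hw]
    have hg2 : g (((c - 1) * y - c * x) / (-((c + 1) * x - c * y))) = (1 + (f w)⁻¹) / 2 := by
      have : (c + 1) * (((c - 1) * y - c * x) / (-((c + 1) * x - c * y))) - c = w⁻¹ := by
        rw [hwy]
        field_simp
        linear_combination c * hwy
      simp only [hgdef, this, hinv]
    rw [planeMap_of_ne _ (neg_ne_zero.2 hξ), hg2, planeMap_of_ne _ hy, hg1, matC_mulVec, hwy]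
    convert SameRay.sameRay_pos_smul_left (R := ℝ) (M := Fin 2 → ℝ) _ hdiv using 1
    ext i
    fin_cases i
    · simp; field_simp; ring
    · simp; field_simp; ring

/-- It suffices to check equivariance on the generators of the group. -/
theorem equivariant_of_generators {c d : ℝ} {φ : Circ → Circ}
    (h : ∀ x r, φ (rayAct (genMat c x) r) = rayAct (genMat d x) (φ r)) (G : GPM) (r : Circ) :
    φ (rayAct (rep c G) r) = rayAct (rep d G) (φ r) := by
  have hG : G ∈ Subgroup.closure (Set.range (PresentedGroup.of : Gen → GPM)) := by
    rw [PresentedGroup.closure_range_of]; trivial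
  induction hG using Subgroup.closure_induction generalizing r with
  | mem G hG =>
    obtain ⟨x, rfl⟩ := hG
    simpa only [rep, PresentedGroup.toGroup.of] using h x r
  | one => simp only [map_one, rayAct_one]
  | mul G H _ _ hG hH => simp only [map_mul, rayAct_mul, hG, hH]
  | inv G _ hG =>
    have h1 := hG (rayAct (rep c G⁻¹) r)
    rw [← rayAct_mul, ← map_mul, mul_inv_cancel, map_one, rayAct_one] at h1
    rw [h1, ← rayAct_mul, ← map_mul, inv_mul_cancel, map_one, rayAct_one]

end Equivariance

end VeechRays

theorem proposition7p2 (c : ℝ) (hc : 1 < c) :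
    ∃ φ : VeechRays.Circ → VeechRays.Circ,
      Continuous φ ∧ VeechRays.IsMonotoneDegreeOne φ ∧
      (∀ (G : VeechRays.GPM) (r : VeechRays.Circ),
        φ (VeechRays.rayAct (VeechRays.rep c G) r) =
          VeechRays.rayAct (VeechRays.rep 1 G) (φ r)) ∧
      φ VeechRays.horizontalRay = VeechRays.horizontalRay ∧
      φ VeechRays.slopeOneRay = VeechRays.slopeOneRay ∧
      ∀ r : VeechRays.Circ, φ (-r) = -φ r := by
  obtain ⟨f, hf, hinv⟩ := VeechRays.exists_isProfile_inv hc
  have hg := hf.isSlopeMap (by linarith)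
  refine ⟨VeechRays.rayMap _, VeechRays.continuous_rayMap hg,
    VeechRays.isMonotoneDegreeOne_rayMap hg, VeechRays.equivariant_of_generators fun x r => ?_,
    VeechRays.rayMap_horizontalRay, VeechRays.rayMap_slopeOneRay hg, VeechRays.rayMap_neg⟩
  induction r using Module.Ray.ind with
  | h v hv =>
    cases x with
    | negI =>
      change VeechRays.rayMap _ (VeechRays.rayAct (-1) _) = VeechRays.rayAct (-1) _
      rw [VeechRays.rayAct_neg_one, VeechRays.rayAct_neg_one, VeechRays.rayMap_neg]
    | A =>
      simp only [VeechRays.rayAct_rayOfNeZero, VeechRays.rayMap_rayOfNeZero]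
      congr 1
      exact VeechRays.planeMap_matA hg v
    | B =>
      simp only [VeechRays.rayAct_rayOfNeZero, VeechRays.rayMap_rayOfNeZero]
      congr 1
      exact VeechRays.planeMap_matB hg v
    | C =>
      simp only [VeechRays.rayAct_rayOfNeZero, VeechRays.rayMap_rayOfNeZero]
      exact (ray_eq_iff _ _).2 (VeechRays.sameRay_planeMap_matC hc hf hinv v)
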